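/- Let $(\Omega,\mathcal F,\mathbb P)$ be a probability space, let $X\subset\mathbb C$ be a finite set, and let $\xi\colon\mathbb Z\to X$ be a wide-sense stationary random process on $(\Omega,\mathcal F,\mathbb P)$ with values in $X$; that is, $\mathbb E|\xi(n)|^2<\infty$ for every $n\in\mathbb Z$, and $\mathbb E\,\xi(n)$ and, for each $m\in\mathbb Z$, $\mathbb E[\xi(n)\overline{\xi(n+m)}]$ do not depend on $n$. Let $\rho$ be its spectral measure, i.e. the finite positive Borel measure on the unit circle $\mathbb T=\{t\in\mathbb C:|t|=1\}$ such that $$\mathbb E\Bigl[\bigl(\xi(0)-\mathbb E\,\xi(0)\bigr)\overline{\bigl(\xi(m)-\mathbb E\,\xi(m)\bigr)}\Bigr]=\int_{\mathbb T}t^{-m}\,d\rho(t)\qquad\text{for all } m\in\mathbb Z.$$ Suppose that the closed support of $\rho$ is not all of $\mathbb T$. Then $\xi$ is periodic: there is a (deterministic) positive integer $N$ such that, almost surely, $\xi(n+N)=\xi(n)$ for all $n\in\mathbb Z$. -/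

import Mathlib

open MeasureTheory ProbabilityTheory
open scoped ComplexConjugate

/-- The unit circle carries its Borel σ-algebra. -/
noncomputable instance Circle.instMeasurableSpaceBorel : MeasurableSpace Circle := borel Circle

instance Circle.instBorelSpaceBorel : BorelSpace Circle := ⟨rfl⟩

/-- A complex random process `ξ` on `ℤ` is wide-sense stationary: `𝔼|ξ(n)|² < ∞`, and neither
`𝔼 ξ(n)` nor `𝔼[ξ(n) conj ξ(n+m)]` depends on `n`. -/
structure IsWideSenseStationary {Ω : Type*} [MeasurableSpace Ω] (ξ : ℤ → Ω → ℂ)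
    (P : Measure Ω) : Prop where
  memLp : ∀ n, MemLp (ξ n) 2 P
  mean_eq : ∀ n n' : ℤ, ∫ ω, ξ n ω ∂P = ∫ ω, ξ n' ω ∂P
  corr_eq : ∀ m n n' : ℤ,
    ∫ ω, ξ n ω * conj (ξ (n + m) ω) ∂P = ∫ ω, ξ n' ω * conj (ξ (n' + m) ω) ∂P

/-- The covariance function `r(m) = 𝔼[(ξ(0) - 𝔼 ξ(0)) conj (ξ(m) - 𝔼 ξ(m))]`. -/
noncomputable def covarianceFunction {Ω : Type*} [MeasurableSpace Ω] (ξ : ℤ → Ω → ℂ)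
    (P : Measure Ω) (m : ℤ) : ℂ :=
  ∫ ω, (ξ 0 ω - ∫ ω', ξ 0 ω' ∂P) * conj (ξ m ω - ∫ ω', ξ m ω' ∂P) ∂P

/-- `ρ` is the spectral measure of `ξ`: the finite positive Borel measure on the unit circle
whose Fourier transform `m ↦ ∫ t⁻ᵐ dρ(t)` is the covariance function of `ξ`. -/
structure IsSpectralMeasure {Ω : Type*} [MeasurableSpace Ω] (ξ : ℤ → Ω → ℂ)
    (P : Measure Ω) (ρ : Measure Circle) : Prop where
  isFinite : IsFiniteMeasure ρ
  fourier_eq : ∀ m : ℤ, covarianceFunction ξ P m = ∫ t : Circle, ((t ^ (-m) : Circle) : ℂ) ∂ρ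

/-- The process `ξ` is periodic: one positive integer `N` is a period of almost every
realization. -/
def IsPeriodicProcess {Ω : Type*} [MeasurableSpace Ω] (ξ : ℤ → Ω → ℂ) (P : Measure Ω) : Prop :=
  ∃ N : ℕ, 0 < N ∧ ∀ᵐ ω ∂P, Function.Periodic (fun n : ℤ => ξ n ω) (N : ℤ)

/-! Choose an absolutely convergent Fourier series `∑ ψ k tᵏ` that vanishes off the spectral gap but
not at some point `t₀` of it. The variable `∑ ψ k (ξ(n+k) - 𝔼ξ)` has second moment `∫ |∑ ψ k tᵏ|² dρ
= 0`, so almost every centred realization is a bounded sequence annihilated by `ψ`.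

On the Banach space of bounded sequences annihilated by `ψ`, the shift `T` is an invertible
isometry. Its spectrum lies in the circle and misses `t₀` (`notMem_spectrum_of_symbol_ne_zero`), so
it does not separate the plane, and `T⁻¹` is a norm limit of polynomials in `T`
(`exists_polynomial_norm_one_sub_lt`). Hence one fixed linear form in finitely many later terms
predicts every term of every realization with uniformly small error
(`exists_polynomial_prediction`).

The values lie in a finite, hence separated, set, so a small enough error means that each term is
determined exactly by the window of terms after it. Pigeonhole on windows then gives a period
depending only on the window length and the alphabet (`periodic_of_determined_by_window`). -/

/-! ### Determinism over a finite alphabet. -/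

/-- A sequence over a finite alphabet, each of whose terms is determined by the next `N` terms,
has the period `(|α| ^ N)!`. -/
theorem periodic_of_determined_by_window {α : Type*} [Fintype α] (N : ℕ) (y : ℤ → α)
    (hdet : ∀ n n' : ℤ, (∀ k : Fin N, y (n + 1 + k) = y (n' + 1 + k)) → y n = y n') :
    Function.Periodic y (((Fintype.card α ^ N).factorial : ℕ) : ℤ) := by
  classical
  set M := Fintype.card α ^ N with hM
  intro m
  -- two of `M + 1` consecutive windows coincide
  obtain ⟨i, j, hij, hW⟩ : ∃ i j : Fin (M + 1), i < j ∧
      ∀ k : Fin N, y (m + M.factorial + i + 1 + k) = y (m + M.factorial + j + 1 + k) := by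
    obtain ⟨i, j, hne, h⟩ := Fintype.exists_ne_map_eq_of_card_lt
      (fun (i : Fin (M + 1)) (k : Fin N) => y (m + M.factorial + i + 1 + k))
      (by simp [hM])
    rcases lt_or_gt_of_ne hne with h' | h'
    · exact ⟨i, j, h', fun k => congrFun h k⟩
    · exact ⟨j, i, h', fun k => (congrFun h k).symm⟩
  -- Equality of two windows at distance `j - i` propagates to the left: the determined term becomes
  -- the first entry of the next window.
  have hback : ∀ q : ℕ, ∀ l : ℤ, l = m + M.factorial + i - q →
      (∀ k : Fin N, y (l + 1 + k) = y (l + (j - i : ℤ) + 1 + k)) ∧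
        y l = y (l + (j - i : ℤ)) := by
    intro q
    induction q with
    | zero =>
      rintro l rfl
      have h1 : ∀ k : Fin N, y (m + M.factorial + i - (0 : ℕ) + 1 + k) =
          y (m + M.factorial + i - (0 : ℕ) + (j - i : ℤ) + 1 + k) := by
        intro k
        convert hW k using 2 <;> push_cast <;> ring
      exact ⟨h1, hdet _ _ h1⟩
    | succ q ih =>
      rintro l hl
      obtain ⟨ihw, ih0⟩ := ih (l + 1) (by rw [hl]; push_cast; ring)
      have h1 : ∀ k : Fin N, y (l + 1 + k) = y (l + (j - i : ℤ) + 1 + k) := by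
        rintro ⟨k, hk⟩
        cases k with
        | zero =>
          convert ih0 using 2 <;> push_cast <;> ring
        | succ k =>
          convert ihw ⟨k, by omega⟩ using 2 <;> push_cast <;> ring
      exact ⟨h1, hdet _ _ h1⟩
  -- The windows were taken to the right of `m + M!`, so that the local period `j - i` holds on all
  -- of `[m, m + M!]`.
  have hstep : ∀ l : ℤ, l ≤ m + M.factorial → y l = y (l + (j - i : ℤ)) := by
    intro l hl
    exact (hback (m + M.factorial + i - l).toNat l (by omega)).2
  obtain ⟨p, hp⟩ : ∃ p : ℕ, (j : ℕ) = i + p := ⟨j - i, by omega⟩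
  have hp0 : 0 < p := by omega
  have hpM : p ≤ M := by omega
  have hpj : (j - i : ℤ) = p := by omega
  -- The local period `p ≤ M` may vary with `m` and `y`; `M!` is a common multiple of all
  -- candidates.
  obtain ⟨q, hq⟩ := Nat.dvd_factorial hp0 hpM
  have hmul : ∀ r : ℕ, r ≤ q → y (m + (p * r : ℕ)) = y m := by
    intro r
    induction r with
    | zero => simp
    | succ r ih =>
      intro hr
      rw [← ih (by omega), hstep (m + (p * r : ℕ)), hpj]
      · congr 1; push_cast; ring
      · have : p * r ≤ M.factorial := hq ▸ Nat.mul_le_mul_left p (by omega)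
        omega
  rw [hq]
  exact hmul q le_rfl

/-! ### Fourier series supported in a gap. -/

/-- For every neighbourhood `U` of a point `t₀` of the circle there is an absolutely convergent
Fourier series with a finite first moment which vanishes off `U` and not at `t₀`. -/
theorem exists_summable_fourier_series_eq_zero_off (t₀ : Circle) {U : Set Circle}
    (hU : U ∈ nhds t₀) :
    ∃ ψ : ℤ → ℂ, Summable (fun k => ‖ψ k‖) ∧ Summable (fun k : ℤ => |(k : ℝ)| * ‖ψ k‖) ∧
      ∑' k, ψ k * ((t₀ ^ k : Circle) : ℂ) ≠ 0 ∧
      ∀ t ∉ U, ∑' k, ψ k * ((t ^ k : Circle) : ℂ) = 0 := by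
  open scoped FourierTransform SchwartzMap in
  let e : ℝ → Circle := fun x => AddCircle.toCircle (x : UnitAddCircle)
  have he : Continuous e := AddCircle.continuous_toCircle.comp (AddCircle.continuous_mk' 1)
  have hesurj : ∀ t, ∃ x, e x = t := by
    intro t
    obtain ⟨z, rfl⟩ := (AddCircle.homeomorphCircle (T := (1 : ℝ)) one_ne_zero).surjective t
    obtain ⟨x, rfl⟩ := QuotientAddGroup.mk_surjective z
    exact ⟨x, by simp [e, AddCircle.homeomorphCircle_apply]⟩
  have hefour : ∀ (k : ℤ) (x : ℝ), fourier k (x : UnitAddCircle) = ((e x ^ k : Circle) : ℂ) := by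
    intro k x
    rw [fourier_apply, AddCircle.toCircle_zsmul]
  have heper : ∀ (x : ℝ) (n : ℤ), e (x + n) = e x := by
    intro x n
    
    simp only [e]
    congr 1
    rw [AddCircle.coe_add]
    have : ((n : ℝ) : UnitAddCircle) = 0 := by
      rw [AddCircle.coe_eq_zero_iff]; exact ⟨n, by simp⟩
    rw [this, add_zero]
  obtain ⟨x₀, rfl⟩ := hesurj t₀
  obtain ⟨r, hr0, hr⟩ := Metric.mem_nhds_iff.1 (he.continuousAt.preimage_mem_nhds hU)
  -- Radius at most `r` keeps the support over `U`; radius at most `1` makes `n = 0` the only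
  -- nonzero term of the periodization at `x₀`.
  let b : ContDiffBump x₀ :=
    { rIn := min r 1 / 2, rOut := min r 1, rIn_pos := by positivity,
      rIn_lt_rOut := half_lt_self (by positivity) }
  have hbs : HasCompactSupport (fun x => ((b x : ℝ) : ℂ)) :=
    b.hasCompactSupport.comp_left (g := fun x : ℝ => (x : ℂ)) (by simp)
  let f : 𝓢(ℝ, ℂ) := hbs.toSchwartzMap (Complex.ofRealCLM.contDiff.comp b.contDiff)
  have hf : ∀ x, f x = b x := fun x => rfl
  have hb0 : ∀ x, min r 1 ≤ dist x x₀ → b x = 0 := fun x hx => b.zero_of_le_dist hx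
  have hdecay : ∀ s : ℝ, (fun k : ℤ => 𝓕 f (k : ℝ)) =O[Filter.cofinite]
      fun k : ℤ => |(k : ℝ)| ^ s := fun s =>
    ((𝓕 f).isBigO_cocompact_rpow s).comp_tendsto Int.tendsto_coe_cofinite
  refine ⟨fun k => 𝓕 f (k : ℝ), ?_, ?_, ?_, ?_⟩
  · exact (summable_of_isBigO (Real.summable_abs_int_rpow one_lt_two) (hdecay (-2))).norm
  · refine summable_of_isBigO (Real.summable_abs_int_rpow one_lt_two) ?_
    have h := (Asymptotics.isBigO_refl (fun k : ℤ => |(k : ℝ)|) Filter.cofinite).mul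
      (hdecay (-3)).norm_left
    refine h.congr' Filter.EventuallyEq.rfl ?_
    filter_upwards [(Set.finite_singleton (0 : ℤ)).compl_mem_cofinite] with k hk
    have hk' : 0 < |(k : ℝ)| := by simpa using hk
    nth_rewrite 1 [← Real.rpow_one |(k : ℝ)|]
    rw [← Real.rpow_add hk']
    norm_num
  -- By Poisson summation, the series is the periodization of the bump.
  · have h := f.tsum_eq_tsum_fourier x₀
    simp only [hefour] at h
    rw [← h, tsum_eq_single 0]
    · rw [hf]
      have : b x₀ = 1 := b.one_of_mem_closedBall (by simp [b.rIn_pos.le])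
      simp [this]
    · intro n hn
      rw [hf, hb0, Complex.ofReal_zero]
      have : (1 : ℝ) ≤ |(n : ℝ)| := by exact_mod_cast Int.one_le_abs hn
      simpa [Real.dist_eq] using Or.inr this
  · intro t ht
    obtain ⟨x, rfl⟩ := hesurj t
    have h := f.tsum_eq_tsum_fourier x
    simp only [hefour] at h
    rw [← h]
    have : ∀ n : ℤ, f (x + n) = 0 := by
      intro n
      rw [hf, hb0, Complex.ofReal_zero]
      by_contra hlt
      refine ht ?_
      rw [← heper x n]
      exact hr (Metric.mem_ball.2 ((not_le.1 hlt).trans_le (min_le_left _ _)))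
    simp [this]

/-! ### Planar topology of the spectrum. -/

/-- The complement of a set on the unit circle which misses a point of the circle is connected. -/
theorem isPreconnected_compl_of_subset_sphere {σ : Set ℂ} (hσ : σ ⊆ Metric.sphere 0 1) {z₀ : ℂ}
    (hz₀ : z₀ ∈ Metric.sphere (0 : ℂ) 1) (hz₀σ : z₀ ∉ σ) : IsPreconnected σᶜ := by
  have hext : IsPreconnected {z : ℂ | 1 < ‖z‖} := by
    have h : IsPreconnected (Complex.exp '' {z : ℂ | 0 < z.re}) :=
      (convex_halfSpace_re_gt 0).isPreconnected.image _ Complex.continuous_exp.continuousOn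
    convert h using 1
    ext z
    constructor
    · intro hz
      have hz' : 1 < ‖z‖ := hz
      have hz0 : z ≠ 0 := norm_pos_iff.1 (zero_lt_one.trans hz')
      exact ⟨Complex.log z, by simpa [Complex.log_re] using Real.log_pos hz', Complex.exp_log hz0⟩
    · rintro ⟨w, hw, rfl⟩
      simpa [Complex.norm_exp] using hw
  -- A set between a connected set and its closure is connected; this is used for the open disc and
  -- for the exterior.
  have hin : IsPreconnected (Metric.closedBall 0 1 \ σ) := by
    refine (Metric.isPreconnected_ball (x := (0 : ℂ)) (r := 1)).subset_closure ?_ ?_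
    · intro z hz
      refine ⟨Metric.ball_subset_closedBall hz, fun h => ?_⟩
      exact (Metric.mem_ball.1 hz).ne (hσ h)
    · rw [closure_ball _ one_ne_zero]
      exact Set.sdiff_subset
  have hout : IsPreconnected ({z : ℂ | 1 ≤ ‖z‖} \ σ) := by
    refine hext.subset_closure ?_ ?_
    · intro z hz
      have hz' : 1 < ‖z‖ := hz
      refine ⟨hz'.le, fun h => ?_⟩
      have := hσ h
      simp at this
      linarith
    · rintro z ⟨hz, -⟩
      have hz' : 1 ≤ ‖z‖ := hz
      refine mem_closure_of_tendsto (b := nhdsWithin (1 : ℝ) (Set.Ioi 1))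
        (f := fun s : ℝ => (s : ℂ) * z) ?_ ?_
      · have : Filter.Tendsto (fun s : ℝ => (s : ℂ) * z) (nhds 1) (nhds (((1 : ℝ) : ℂ) * z)) :=
          (Continuous.tendsto (by fun_prop) 1)
        simpa using this.mono_left nhdsWithin_le_nhds
      · filter_upwards [self_mem_nhdsWithin] with s hs
        have hs' : (1 : ℝ) < s := hs
        simp only [norm_mul, Complex.norm_real, Real.norm_eq_abs]
        rw [abs_of_pos (by linarith)]
        nlinarith
  have hunion : σᶜ = (Metric.closedBall 0 1 \ σ) ∪ ({z : ℂ | 1 ≤ ‖z‖} \ σ) := by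
    ext z
    have := le_total ‖z‖ 1
    simp
    tauto
  rw [hunion]
  have hz1 : ‖z₀‖ = 1 := by simpa using hz₀
  exact hin.union z₀ ⟨by simp [hz1], hz₀σ⟩ ⟨hz1.ge, hz₀σ⟩ hout

/-! ### Spectrum of a contractive group. -/

section PowerBoundedGroup

variable {A : Type*} [NormedRing A] [NormedAlgebra ℂ A] {T : ℤ → A}

/-- `lᵏ - Tᵏ` is a multiple of `l - T` by an element of norm at most `|k|`. -/
theorem exists_mul_eq_zpow_sub (h0 : T 0 = 1) (hadd : ∀ k l, T (k + l) = T k * T l)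
    (hnorm : ∀ k, ‖T k‖ ≤ 1) {l : ℂ} (hl : ‖l‖ = 1) (k : ℤ) :
    ∃ g : A, ‖g‖ ≤ |(k : ℝ)| ∧ (algebraMap ℂ A l - T 1) * g = algebraMap ℂ A (l ^ k) - T k ∧
      g * (algebraMap ℂ A l - T 1) = algebraMap ℂ A (l ^ k) - T k := by
  have hl0 : l ≠ 0 := norm_pos_iff.1 (by rw [hl]; exact one_pos)
  induction k using Int.induction_on with
  | zero => exact ⟨0, by simp [h0]⟩
  | succ k ih =>
    obtain ⟨g, hg, h1, h2⟩ := ih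
    -- `lᵏ⁺¹ - Tᵏ⁺¹ = l (lᵏ - Tᵏ) + (l - T) Tᵏ`; the `pred` case solves the same identity for the
    -- lower power.
    refine ⟨l • g + T k, ?_, ?_, ?_⟩
    · calc ‖l • g + T k‖ ≤ ‖l • g‖ + ‖T k‖ := norm_add_le _ _
        _ ≤ |((k : ℤ) : ℝ)| + 1 := by
          rw [norm_smul, hl, one_mul]
          exact add_le_add hg (hnorm _)
        _ = _ := by
          push_cast
          rw [abs_of_nonneg (by positivity), abs_of_nonneg (by positivity)]
    · rw [mul_add, mul_smul_comm, h1, zpow_add_one₀ hl0, add_comm (k : ℤ) 1, hadd]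
      simp only [Algebra.algebraMap_eq_smul_one, smul_sub, sub_mul, smul_mul_assoc, one_mul, smul_smul]
      rw [mul_comm l]
      abel
    · rw [add_mul, smul_mul_assoc, h2, zpow_add_one₀ hl0, hadd]
      simp only [Algebra.algebraMap_eq_smul_one, smul_sub, mul_sub, mul_smul_comm, mul_one, smul_smul]
      rw [mul_comm l]
      abel
  | pred k ih =>
    obtain ⟨g, hg, h1, h2⟩ := ih
    have hT : T (-k) = T 1 * T (-k - 1) := by rw [← hadd]; congr 1; ring
    have hT' : T (-k) = T (-k - 1) * T 1 := by rw [← hadd]; congr 1; ring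
    refine ⟨l⁻¹ • (g - T (-k - 1)), ?_, ?_, ?_⟩
    · calc ‖l⁻¹ • (g - T (-k - 1))‖ ≤ ‖g‖ + ‖T (-k - 1)‖ := by
            rw [norm_smul, norm_inv, hl, inv_one, one_mul]; exact norm_sub_le _ _
        _ ≤ |((-k : ℤ) : ℝ)| + 1 := add_le_add hg (hnorm _)
        _ = _ := by
          push_cast
          rw [abs_neg, abs_of_nonneg (by positivity), ← neg_add', abs_neg,
            abs_of_nonneg (by positivity)]
    · rw [mul_smul_comm, mul_sub, h1, hT, zpow_sub_one₀ hl0]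
      simp only [Algebra.algebraMap_eq_smul_one, smul_sub, sub_mul, smul_mul_assoc, one_mul, smul_smul]
      rw [inv_mul_cancel₀ hl0, mul_comm l⁻¹, one_smul]
      abel
    · rw [smul_mul_assoc, sub_mul, h2, hT', zpow_sub_one₀ hl0]
      simp only [Algebra.algebraMap_eq_smul_one, smul_sub, mul_sub, mul_smul_comm, mul_one, smul_smul]
      rw [inv_mul_cancel₀ hl0, mul_comm l⁻¹, one_smul]
      abel

variable [CompleteSpace A]

/-- If `∑ ψ k Tᵏ = 0` while the symbol `∑ ψ k zᵏ` does not vanish at a point `l` of the unit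
circle, then `l` is not in the spectrum of `T`. -/
theorem notMem_spectrum_of_symbol_ne_zero (h0 : T 0 = 1) (hadd : ∀ k l, T (k + l) = T k * T l)
    (hnorm : ∀ k, ‖T k‖ ≤ 1) {l : ℂ} (hl : ‖l‖ = 1) {ψ : ℤ → ℂ}
    (hψ : Summable fun k => ‖ψ k‖) (hψ1 : Summable fun k : ℤ => |(k : ℝ)| * ‖ψ k‖)
    (hT : HasSum (fun k => ψ k • T k) 0) (hne : ∑' k, ψ k * l ^ k ≠ 0) :
    l ∉ spectrum ℂ (T 1) := by
  choose g hg hg1 hg2 using exists_mul_eq_zpow_sub h0 hadd hnorm hl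
  set c := ∑' k, ψ k * l ^ k with hc
  have hsl : HasSum (fun k => ψ k * l ^ k) c := by
    refine Summable.hasSum (Summable.of_norm ?_)
    simpa [norm_zpow, hl] using hψ
  -- The finite first moment of `ψ` gives convergence here; the sum, divided by `c`, inverts `l -
  -- T`.
  have hsg : HasSum (fun k => ψ k • g k) (∑' k, ψ k • g k) := by
    refine Summable.hasSum (Summable.of_norm_bounded hψ1 fun k => ?_)
    rw [norm_smul, mul_comm]
    exact mul_le_mul_of_nonneg_right (hg k) (norm_nonneg _)
  have hs : HasSum (fun k => ψ k • (algebraMap ℂ A (l ^ k) - T k)) (algebraMap ℂ A c) := by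
    have h := ((algebraMapCLM ℂ A).hasSum hsl).sub hT
    simpa [mul_sub, Algebra.smul_def] using h
  have e1 : (algebraMap ℂ A l - T 1) * ∑' k, ψ k • g k = algebraMap ℂ A c := by
    refine (hsg.mul_left _).unique ?_
    simpa only [mul_smul_comm, hg1] using hs
  have e2 : (∑' k, ψ k • g k) * (algebraMap ℂ A l - T 1) = algebraMap ℂ A c := by
    refine (hsg.mul_right _).unique ?_
    simpa only [smul_mul_assoc, hg2] using hs
  rw [spectrum.notMem_iff]
  refine ⟨⟨_, c⁻¹ • ∑' k, ψ k • g k, ?_, ?_⟩, rfl⟩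
  · rw [mul_smul_comm, e1, Algebra.algebraMap_eq_smul_one, smul_smul, inv_mul_cancel₀ hne, one_smul]
  · rw [smul_mul_assoc, e2, Algebra.algebraMap_eq_smul_one, smul_smul, inv_mul_cancel₀ hne, one_smul]

/-- Both `T` and `T⁻¹` are contractions, so a spectral value and its inverse both have modulus at
most one. -/
theorem spectrum_subset_sphere_of_norm_zpow_le_one (h0 : T 0 = 1)
    (hadd : ∀ k l, T (k + l) = T k * T l) (hnorm : ∀ k, ‖T k‖ ≤ 1) :
    spectrum ℂ (T 1) ⊆ Metric.sphere 0 1 := by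
  have hone : ‖(1 : A)‖ ≤ 1 := h0 ▸ hnorm 0
  have hle : ∀ (k : ℤ) (z : ℂ), z ∈ spectrum ℂ (T k) → ‖z‖ ≤ 1 := fun k z hz =>
    (spectrum.norm_le_norm_mul_of_mem hz).trans
      (mul_le_one₀ (hnorm k) (norm_nonneg _) hone)
  let u : Aˣ := ⟨T 1, T (-1), by rw [← hadd]; simpa using h0, by rw [← hadd]; simpa using h0⟩
  intro z hz
  have hz0 : z ≠ 0 := spectrum.ne_zero_of_mem_of_unit (a := u) hz
  have hinv : z⁻¹ ∈ spectrum ℂ (T (-1)) := (spectrum.inv₀_mem_iff (r := z) (a := u⁻¹)).2 hz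
  have h1 := hle 1 z hz
  have h2 := hle (-1) _ hinv
  rw [norm_inv] at h2
  have h3 : 1 ≤ ‖z‖ := (inv_le_one₀ (norm_pos_iff.2 hz0)).1 h2
  simpa using le_antisymm h1 h3

/-- Under a gap in the spectrum, the inverse of `T` is a limit of polynomials in `T`. -/
theorem exists_polynomial_norm_one_sub_lt (h0 : T 0 = 1) (hadd : ∀ k l, T (k + l) = T k * T l)
    (hnorm : ∀ k, ‖T k‖ ≤ 1) {l : ℂ} (hl : ‖l‖ = 1) {ψ : ℤ → ℂ}
    (hψ : Summable fun k => ‖ψ k‖) (hψ1 : Summable fun k : ℤ => |(k : ℝ)| * ‖ψ k‖)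
    (hT : HasSum (fun k => ψ k • T k) 0) (hne : ∑' k, ψ k * l ^ k ≠ 0) {ε : ℝ} (hε : 0 < ε) :
    ∃ p : Polynomial ℂ, ‖1 - T 1 * Polynomial.aeval (T 1) p‖ < ε := by
  let S : Subalgebra ℂ A := (Algebra.adjoin ℂ {T 1}).topologicalClosure
  have hSc : IsClosed (S : Set A) := Subalgebra.isClosed_topologicalClosure _
  let x : S := ⟨T 1, Subalgebra.le_topologicalClosure _ (Algebra.self_mem_adjoin_singleton ℂ _)⟩
  have hsub := spectrum_subset_sphere_of_norm_zpow_le_one h0 hadd hnorm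
  have hconn : IsPreconnected (spectrum ℂ (x : A))ᶜ :=
    isPreconnected_compl_of_subset_sphere hsub (by simpa using hl)
      (notMem_spectrum_of_symbol_ne_zero h0 hadd hnorm hl hψ hψ1 hT hne)
  -- Passing to a closed subalgebra can only fill holes of the spectrum, and here there are none; so
  -- `T` is already invertible in the closure of the polynomials in `T`.
  have heq := Subalgebra.spectrum_eq_of_isPreconnected_compl S x hconn
  have hx : IsUnit x := by
    rw [← spectrum.zero_notMem_iff ℂ, heq]
    intro h
    simpa using hsub h
  obtain ⟨v, hv⟩ := hx.exists_right_inv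
  have hvA : T 1 * (v : A) = 1 := congrArg Subtype.val hv
  have hvc : (v : A) ∈ closure (Algebra.adjoin ℂ {T 1} : Set A) := v.2
  obtain ⟨w, hw, hwv⟩ := Metric.mem_closure_iff.1 hvc ε hε
  obtain ⟨p, rfl⟩ := (Algebra.adjoin_mem_exists_aeval ℂ (T 1) hw)
  refine ⟨p, ?_⟩
  rw [← hvA, ← mul_sub]
  calc _ ≤ ‖T 1‖ * ‖(v : A) - Polynomial.aeval (T 1) p‖ := norm_mul_le _ _
    _ ≤ 1 * ‖(v : A) - Polynomial.aeval (T 1) p‖ :=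
      mul_le_mul_of_nonneg_right (hnorm 1) (norm_nonneg _)
    _ < ε := by rwa [one_mul, ← dist_eq_norm]

end PowerBoundedGroup

section OperatorGroup

variable {E : Type*} [NormedAddCommGroup E] [NormedSpace ℂ E] [CompleteSpace E]

/-- A power-bounded group of operators `Tᵏ` with `∑ ψ k Tᵏ = 0`, whose symbol does not vanish at
some point of the circle: `T⁻¹` is a limit of polynomials in `T`. -/
theorem exists_polynomial_norm_sub_apply_le {T : ℤ → E →L[ℂ] E} (h0 : T 0 = 1)
    (hadd : ∀ k l, T (k + l) = T k * T l) (hnorm : ∀ k, ‖T k‖ ≤ 1) {l : ℂ} (hl : ‖l‖ = 1)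
    {ψ : ℤ → ℂ} (hψ : Summable fun k => ‖ψ k‖)
    (hψ1 : Summable fun k : ℤ => |(k : ℝ)| * ‖ψ k‖)
    (hT : ∀ y, HasSum (fun k => ψ k • T k y) 0) (hne : ∑' k, ψ k * l ^ k ≠ 0)
    {ε : ℝ} (hε : 0 < ε) :
    ∃ p : Polynomial ℂ, ∀ y, ‖y - T 1 (Polynomial.aeval (T 1) p y)‖ ≤ ε * ‖y‖ := by
  have hs : Summable fun k => ψ k • T k :=
    Summable.of_norm_bounded hψ fun k => by
      rw [norm_smul]
      exact mul_le_of_le_one_right (norm_nonneg _) (hnorm k)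
  have hT0 : HasSum (fun k => ψ k • T k) 0 := by
    convert hs.hasSum
    ext y
    have h := (ContinuousLinearMap.apply ℂ E y).hasSum hs.hasSum
    simp only [ContinuousLinearMap.apply_apply, smul_apply] at h
    exact (hT y).unique h
  obtain ⟨p, hp⟩ := exists_polynomial_norm_one_sub_lt h0 hadd hnorm hl hψ hψ1 hT0 hne hε
  exact ⟨p, fun y => ContinuousLinearMap.le_of_opNorm_le _ hp.le y⟩

end OperatorGroup

/-! ### The shift on annihilated bounded sequences. -/

section Shift

open scoped BoundedContinuousFunction

/-- The shift `y ↦ y (· + k)` on bounded two-sided sequences. -/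
noncomputable def boundedShift (k : ℤ) : (ℤ →ᵇ ℂ) →L[ℂ] (ℤ →ᵇ ℂ) :=
  LinearMap.mkContinuous
    { toFun := fun y => y.compContinuous ⟨fun n => n + k, by fun_prop⟩
      map_add' := fun _ _ => rfl
      map_smul' := fun _ _ => rfl } 1
    (fun y => by
      rw [one_mul]
      exact (BoundedContinuousFunction.norm_le (norm_nonneg _)).2 fun n => y.norm_coe_le_norm _)

@[simp]
theorem boundedShift_apply (k : ℤ) (y : ℤ →ᵇ ℂ) (n : ℤ) : boundedShift k y n = y (n + k) := rfl

theorem norm_boundedShift_le (k : ℤ) : ‖boundedShift k‖ ≤ 1 :=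
  LinearMap.mkContinuous_norm_le _ zero_le_one _

/-- The bounded sequences annihilated by correlation with `ψ`. -/
noncomputable def annihilated (ψ : ℤ → ℂ) : Submodule ℂ (ℤ →ᵇ ℂ) :=
  LinearMap.ker (∑' k, ψ k • boundedShift k : (ℤ →ᵇ ℂ) →L[ℂ] (ℤ →ᵇ ℂ)).toLinearMap

instance completeSpace_annihilated (ψ : ℤ → ℂ) : CompleteSpace (annihilated ψ) :=
  (ContinuousLinearMap.isClosed_ker (∑' k, ψ k • boundedShift k)).isComplete.completeSpace_coe

variable {ψ : ℤ → ℂ}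

theorem hasSum_smul_boundedShift_apply (hψ : Summable fun k => ‖ψ k‖) (y : ℤ →ᵇ ℂ) (n : ℤ) :
    HasSum (fun k => ψ k * y (n + k)) ((∑' k, ψ k • boundedShift k) y n) := by
  have hs : Summable fun k => ψ k • boundedShift k :=
    Summable.of_norm_bounded hψ fun k => by
      rw [norm_smul]
      exact mul_le_of_le_one_right (norm_nonneg _) (norm_boundedShift_le k)
  have h := (BoundedContinuousFunction.evalCLM ℂ n).hasSum
    ((ContinuousLinearMap.apply ℂ (ℤ →ᵇ ℂ) y).hasSum hs.hasSum)
  simpa using h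

theorem mem_annihilated_iff (hψ : Summable fun k => ‖ψ k‖) {y : ℤ →ᵇ ℂ} :
    y ∈ annihilated ψ ↔ ∀ n, ∑' k, ψ k * y (n + k) = 0 := by
  simp only [fun n => (hasSum_smul_boundedShift_apply hψ y n).tsum_eq]
  rw [annihilated, LinearMap.mem_ker]
  exact ⟨fun h n => DFunLike.congr_fun h n, fun h => BoundedContinuousFunction.ext h⟩

attribute [irreducible] annihilated

theorem boundedShift_mem_annihilated (hψ : Summable fun k => ‖ψ k‖) (k : ℤ) {y : ℤ →ᵇ ℂ}
    (hy : y ∈ annihilated ψ) : boundedShift k y ∈ annihilated ψ := by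
  rw [mem_annihilated_iff hψ] at hy ⊢
  intro n
  rw [← hy (n + k)]
  refine tsum_congr fun l => ?_
  rw [boundedShift_apply, add_right_comm]

/-- The restriction of the shift to the sequences annihilated by `ψ`. -/
noncomputable def annihilatedShift (hψ : Summable fun k => ‖ψ k‖) (k : ℤ) :
    annihilated ψ →L[ℂ] annihilated ψ :=
  ((boundedShift k).comp (annihilated ψ).subtypeL).codRestrict (annihilated ψ)
    fun y => boundedShift_mem_annihilated hψ k y.2

theorem annihilatedShift_apply (hψ : Summable fun k => ‖ψ k‖) (k : ℤ) (y : annihilated ψ) (n : ℤ) :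
    (annihilatedShift hψ k y : ℤ →ᵇ ℂ) n = (y : ℤ →ᵇ ℂ) (n + k) := rfl

theorem annihilatedShift_zero (hψ : Summable fun k => ‖ψ k‖) : annihilatedShift hψ 0 = 1 := by
  ext y n
  simp [annihilatedShift_apply]

theorem annihilatedShift_add (hψ : Summable fun k => ‖ψ k‖) (k l : ℤ) :
    annihilatedShift hψ (k + l) = annihilatedShift hψ k * annihilatedShift hψ l := by
  ext y n
  simp [annihilatedShift_apply, add_assoc]

theorem norm_annihilatedShift_le (hψ : Summable fun k => ‖ψ k‖) (k : ℤ) :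
    ‖annihilatedShift hψ k‖ ≤ 1 := by
  refine ContinuousLinearMap.opNorm_le_bound _ zero_le_one fun y => ?_
  exact (boundedShift k).le_of_opNorm_le (norm_boundedShift_le k) (y : ℤ →ᵇ ℂ)

theorem hasSum_smul_annihilatedShift_apply (hψ : Summable fun k => ‖ψ k‖) (y : annihilated ψ) :
    HasSum (fun k => ψ k • annihilatedShift hψ k y) 0 := by
  have hs : Summable fun k => ψ k • annihilatedShift hψ k y :=
    Summable.of_norm_bounded (hψ.mul_right ‖y‖) fun k => by
      rw [norm_smul]
      refine mul_le_mul_of_nonneg_left ?_ (norm_nonneg _)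
      exact ((annihilatedShift hψ k).le_of_opNorm_le (norm_annihilatedShift_le hψ k) y).trans_eq
        (one_mul _)
  convert hs.hasSum
  ext n
  have h := (BoundedContinuousFunction.evalCLM ℂ n).hasSum ((annihilated ψ).subtypeL.hasSum
    hs.hasSum)
  have h' := (mem_annihilated_iff hψ).1 y.2 n
  exact h'.symm.trans h.tsum_eq

theorem annihilatedShift_pow_apply (hψ : Summable fun k => ‖ψ k‖) (j : ℕ) (y : annihilated ψ)
    (n : ℤ) : ((annihilatedShift hψ 1 ^ j) y : ℤ →ᵇ ℂ) n = (y : ℤ →ᵇ ℂ) (n + j) := by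
  induction j generalizing n with
  | zero => simp
  | succ j ih =>
    rw [pow_succ', mul_apply_eq_comp, annihilatedShift_apply, ih]
    congr 1
    push_cast
    ring

/-- Bounded sequences annihilated by `ψ` are predicted, with a uniformly small error, by a fixed
linear form in finitely many of the subsequent terms. -/
theorem exists_polynomial_prediction (hψ : Summable fun k => ‖ψ k‖)
    (hψ1 : Summable fun k : ℤ => |(k : ℝ)| * ‖ψ k‖) {l : ℂ} (hl : ‖l‖ = 1)
    (hne : ∑' k, ψ k * l ^ k ≠ 0) {ε : ℝ} (hε : 0 < ε) :
    ∃ p : Polynomial ℂ, ∀ y : ℤ → ℂ, ∀ R : ℝ, (∀ n, ‖y n‖ ≤ R) →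
      (∀ n, ∑' k, ψ k * y (n + k) = 0) →
        ∀ n : ℤ, ‖y n - ∑ j ∈ Finset.range (p.natDegree + 1), p.coeff j * y (n + 1 + j)‖ ≤ ε * R := by
  obtain ⟨p, hp⟩ := exists_polynomial_norm_sub_apply_le (annihilatedShift_zero hψ)
    (annihilatedShift_add hψ) (norm_annihilatedShift_le hψ) hl hψ hψ1
    (hasSum_smul_annihilatedShift_apply hψ) hne hε
  refine ⟨p, fun y R hR hy n => ?_⟩
  let Y : ℤ →ᵇ ℂ := BoundedContinuousFunction.ofNormedAddCommGroup y (by fun_prop) R hR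
  have hYa : Y ∈ annihilated ψ := (mem_annihilated_iff hψ).2 hy
  have hR0 : 0 ≤ R := (norm_nonneg _).trans (hR 0)
  have hYR : ‖Y‖ ≤ R := BoundedContinuousFunction.norm_ofNormedAddCommGroup_le _ hR0 hR
  let Z : annihilated ψ := ⟨Y, hYa⟩
  -- The value of `W` at `n` is the prediction error: `Tʲ` reads the term `j` places later, and the
  -- outer `T` adds the offset `1`.
  set W := Z - annihilatedShift hψ 1 (Polynomial.aeval (annihilatedShift hψ 1) p Z) with hW
  have hbound : ‖(W : ℤ →ᵇ ℂ) n‖ ≤ ε * R :=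
    ((W : ℤ →ᵇ ℂ).norm_coe_le_norm n).trans ((hp Z).trans
      (mul_le_mul_of_nonneg_left hYR hε.le))
  have hval : (W : ℤ →ᵇ ℂ) n =
      y n - ∑ j ∈ Finset.range (p.natDegree + 1), p.coeff j * y (n + 1 + j) := by
    rw [hW, Submodule.coe_sub, BoundedContinuousFunction.sub_apply, annihilatedShift_apply,
      Polynomial.aeval_eq_sum_range]
    simp only [sum_apply, smul_apply, Submodule.coe_sum, Submodule.coe_smul,
      BoundedContinuousFunction.coe_sum, Finset.sum_apply, BoundedContinuousFunction.coe_smul,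
      annihilatedShift_pow_apply, smul_eq_mul]
    rfl
  rwa [hval] at hbound

end Shift

/-! ### Gram matrices and spectral isometry. -/

/-- The second moment of an absolutely convergent combination of uniformly bounded functions, in
terms of their Gram matrix. -/
theorem integral_normSq_tsum_eq {α : Type*} [MeasurableSpace α] {μ : Measure α}
    [IsFiniteMeasure μ] {f : ℤ → α → ℂ} (hf : ∀ k, AEStronglyMeasurable (f k) μ) {R : ℝ}
    (hR : ∀ k, ∀ᵐ a ∂μ, ‖f k a‖ ≤ R) {ψ : ℤ → ℂ} (hψ : Summable fun k => ‖ψ k‖) :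
    ∫ a, (∑' k, ψ k * f k a) * conj (∑' k, ψ k * f k a) ∂μ =
      ∑' q : ℤ × ℤ, ψ q.1 * conj (ψ q.2) * ∫ a, f q.1 a * conj (f q.2 a) ∂μ := by
  have hall : ∀ᵐ a ∂μ, ∀ k, ‖f k a‖ ≤ R := ae_all_iff.2 hR
  let F : ℤ × ℤ → α → ℂ := fun q a => ψ q.1 * conj (ψ q.2) * (f q.1 a * conj (f q.2 a))
  have hFm : ∀ q, AEStronglyMeasurable (F q) μ := fun q =>
    ((hf q.1).mul (Complex.continuous_conj.comp_aestronglyMeasurable (hf q.2))).const_mul _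
  have hFb : ∀ q, ∀ᵐ a ∂μ, ‖F q a‖ ≤ ‖ψ q.1‖ * ‖ψ q.2‖ * (R * R) := by
    intro q
    filter_upwards [hR q.1, hR q.2] with a h1 h2
    simp only [F, norm_mul, RCLike.norm_conj]
    have := mul_le_mul h1 h2 (norm_nonneg _) ((norm_nonneg _).trans h1)
    gcongr
  have hFi : ∀ q, Integrable (F q) μ := fun q => Integrable.of_bound (hFm q) _ (hFb q)
  have hprod : Summable fun q : ℤ × ℤ => ‖ψ q.1‖ * ‖ψ q.2‖ :=
    hψ.mul_of_nonneg hψ (fun _ => norm_nonneg _) (fun _ => norm_nonneg _)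
  have hFs : Summable fun q => ∫ a, ‖F q a‖ ∂μ := by
    refine Summable.of_nonneg_of_le (fun q => integral_nonneg fun a => norm_nonneg _) (fun q => ?_)
      (hprod.mul_right (R * R * μ.real Set.univ))
    calc ∫ a, ‖F q a‖ ∂μ ≤ ∫ _, ‖ψ q.1‖ * ‖ψ q.2‖ * (R * R) ∂μ :=
          integral_mono_ae (hFi q).norm (integrable_const _) (hFb q)
      _ = _ := by rw [integral_const, smul_eq_mul]; ring
  have h := hasSum_integral_of_summable_integral_norm hFi hFs
  have hL : ∫ a, (∑' k, ψ k * f k a) * conj (∑' k, ψ k * f k a) ∂μ = ∫ a, ∑' q, F q a ∂μ := by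
    refine integral_congr_ae ?_
    filter_upwards [hall] with a ha
    have hs : Summable fun k => ‖ψ k * f k a‖ := by
      refine Summable.of_nonneg_of_le (fun k => norm_nonneg _) (fun k => ?_) (hψ.mul_right R)
      rw [norm_mul]
      exact mul_le_mul_of_nonneg_left (ha k) (norm_nonneg _)
    rw [Complex.conj_tsum, tsum_mul_tsum_of_summable_norm hs (by simpa using hs)]
    refine tsum_congr fun q => ?_
    simp only [F, map_mul]
    ring
  rw [hL, ← h.tsum_eq]
  refine tsum_congr fun q => ?_
  simp only [F]
  rw [integral_const_mul]

/-- Two uniformly bounded families with the same Gram matrix: if a combination of the second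
vanishes almost everywhere, so does the same combination of the first. -/
theorem ae_tsum_eq_zero_of_gram_eq {α β : Type*} [MeasurableSpace α] [MeasurableSpace β]
    {μ : Measure α} {ν : Measure β} [IsFiniteMeasure μ] [IsFiniteMeasure ν] {f : ℤ → α → ℂ}
    {g : ℤ → β → ℂ} (hf : ∀ k, AEStronglyMeasurable (f k) μ)
    (hg : ∀ k, AEStronglyMeasurable (g k) ν) {R R' : ℝ} (hR : ∀ k, ∀ᵐ a ∂μ, ‖f k a‖ ≤ R)
    (hR' : ∀ k, ∀ᵐ b ∂ν, ‖g k b‖ ≤ R')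
    (hgram : ∀ k l, ∫ a, f k a * conj (f l a) ∂μ = ∫ b, g k b * conj (g l b) ∂ν)
    {ψ : ℤ → ℂ} (hψ : Summable fun k => ‖ψ k‖) (hzero : ∀ᵐ b ∂ν, ∑' k, ψ k * g k b = 0) :
    ∀ᵐ a ∂μ, ∑' k, ψ k * f k a = 0 := by
  have hall : ∀ᵐ a ∂μ, ∀ k, ‖f k a‖ ≤ R := ae_all_iff.2 hR
  have hsum : ∀ᵐ a ∂μ, Summable fun k => ψ k * f k a := by
    filter_upwards [hall] with a ha
    refine Summable.of_norm_bounded (hψ.mul_right R) fun k => ?_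
    rw [norm_mul]
    exact mul_le_mul_of_nonneg_left (ha k) (norm_nonneg _)
  have hmeas : AEStronglyMeasurable (fun a => ∑' k, ψ k * f k a) μ := by
    refine aestronglyMeasurable_of_tendsto_ae (Filter.atTop : Filter (Finset ℤ))
      (f := fun s a => ∑ k ∈ s, ψ k * f k a) (fun s => ?_) ?_
    · exact Finset.aestronglyMeasurable_fun_sum s fun k _ => (hf k).const_mul _
    · filter_upwards [hsum] with a ha using ha.hasSum
  have hbound : ∀ᵐ a ∂μ, ‖∑' k, ψ k * f k a‖ ≤ (∑' k, ‖ψ k‖) * R := by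
    filter_upwards [hall] with a ha
    rw [← tsum_mul_right]
    refine tsum_of_norm_bounded (hψ.mul_right R).hasSum fun k => ?_
    rw [norm_mul]
    exact mul_le_mul_of_nonneg_left (ha k) (norm_nonneg _)
  have hzero' : ∫ a, (∑' k, ψ k * f k a) * conj (∑' k, ψ k * f k a) ∂μ = 0 := by
    rw [integral_normSq_tsum_eq hf hR hψ]
    simp only [hgram]
    rw [← integral_normSq_tsum_eq hg hR' hψ, ← integral_zero β ℂ]
    refine integral_congr_ae ?_
    filter_upwards [hzero] with b hb
    simp [hb]
  have hreal : ∫ a, ‖∑' k, ψ k * f k a‖ ^ 2 ∂μ = 0 := by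
    have : ∫ a, (((‖∑' k, ψ k * f k a‖ ^ 2 : ℝ)) : ℂ) ∂μ = 0 := by
      rw [← hzero']
      refine integral_congr_ae (Filter.Eventually.of_forall fun a => ?_)
      simp [Complex.mul_conj']
    rw [integral_complex_ofReal] at this
    exact_mod_cast this
  have hint : Integrable (fun a => ‖∑' k, ψ k * f k a‖ ^ 2) μ := by
    refine Integrable.of_bound (hmeas.norm.pow 2) (((∑' k, ‖ψ k‖) * R) ^ 2) ?_
    filter_upwards [hbound] with a ha
    rw [norm_pow, norm_norm]
    gcongr
  have := (integral_eq_zero_iff_of_nonneg (fun a => by positivity) hint).1 hreal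
  filter_upwards [this] with a ha
  simpa using ha

namespace IsWideSenseStationary

variable {Ω : Type*} [MeasurableSpace Ω] {P : Measure Ω} [IsProbabilityMeasure P] {ξ : ℤ → Ω → ℂ}

/-- The centred correlations of a wide-sense stationary process. -/
theorem integral_centered_mul_conj (hξ : IsWideSenseStationary ξ P) (k l : ℤ) :
    ∫ ω, (ξ k ω - ∫ ω', ξ 0 ω' ∂P) * conj (ξ l ω - ∫ ω', ξ 0 ω' ∂P) ∂P =
      covarianceFunction ξ P (l - k) := by
  set m := ∫ ω', ξ 0 ω' ∂P with hm
  have hi : ∀ n, Integrable (ξ n) P := fun n => (hξ.memLp n).integrable one_le_two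
  have hmean : ∀ n, ∫ ω, ξ n ω ∂P = m := fun n => hξ.mean_eq n 0
  have hconj : ∀ n, MemLp (fun ω => conj (ξ n ω)) 2 P := fun n => (hξ.memLp n).star
  have hic : ∀ n, Integrable (fun ω => conj (ξ n ω)) P := fun n =>
    (hconj n).integrable one_le_two
  have key : ∀ a b : ℤ, ∫ ω, (ξ a ω - m) * conj (ξ b ω - m) ∂P =
      ∫ ω, ξ a ω * conj (ξ b ω) ∂P - m * conj m := by
    intro a b
    have hab : Integrable (fun ω => ξ a ω * conj (ξ b ω)) P := (hξ.memLp a).integrable_mul (hconj b)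
    have e : ∀ ω, (ξ a ω - m) * conj (ξ b ω - m) =
        ξ a ω * conj (ξ b ω) - ξ a ω * conj m - (m * conj (ξ b ω) - m * conj m) := by
      intro ω; rw [map_sub]; ring
    simp only [e]
    have h1 : Integrable (fun ω => ξ a ω * conj m) P := (hi a).mul_const _
    have h2 : Integrable (fun ω => m * conj (ξ b ω)) P := (hic b).const_mul _
    have h3 : Integrable (fun _ : Ω => m * conj m) P := integrable_const _
    have h4 : Integrable (fun ω => ξ a ω * conj (ξ b ω) - ξ a ω * conj m) P := hab.sub h1
    have h5 : Integrable (fun ω => m * conj (ξ b ω) - m * conj m) P := h2.sub h3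
    rw [integral_sub h4 h5, integral_sub hab h1, integral_sub h2 h3, integral_mul_const,
      integral_const_mul, integral_conj, hmean, hmean]
    simp
  rw [key, covarianceFunction, hmean, hmean, key]
  have := hξ.corr_eq (l - k) k 0
  rw [add_sub_cancel, zero_add] at this
  rw [this]

/-- If the spectral measure vanishes on `U`, a correlation filter whose symbol is supported in `U`
annihilates almost every realization of the centred process. -/
theorem ae_tsum_mul_centered_eq_zero (hξ : IsWideSenseStationary ξ P) {R : ℝ}
    (hR : ∀ n, ∀ᵐ ω ∂P, ‖ξ n ω - ∫ ω', ξ 0 ω' ∂P‖ ≤ R) {ρ : Measure Circle}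
    (hρ : IsSpectralMeasure ξ P ρ) {U : Set Circle} (hU : ρ U = 0) {ψ : ℤ → ℂ}
    (hψ : Summable fun k => ‖ψ k‖) (hsupp : ∀ t ∉ U, ∑' k, ψ k * ((t ^ k : Circle) : ℂ) = 0) :
    ∀ᵐ ω ∂P, ∀ n, ∑' k, ψ k * (ξ (n + k) ω - ∫ ω', ξ 0 ω' ∂P) = 0 := by
  have := hρ.isFinite
  refine ae_all_iff.2 fun n => ?_
  -- The centred variables `ξ(n+k)` and the characters `tᵏ` in `L²(ρ)` have the same Gram matrix; by
  -- stationarity `n` drops out.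
  refine ae_tsum_eq_zero_of_gram_eq (ν := ρ) (R := R) (R' := 1)
    (f := fun k ω => ξ (n + k) ω - ∫ ω', ξ 0 ω' ∂P)
    (g := fun k t => ((t ^ k : Circle) : ℂ)) (fun k => ?_) (fun k => ?_) (fun k => hR _)
    (fun k => ?_) (fun k l => ?_) hψ ?_
  · exact (hξ.memLp _).1.sub aestronglyMeasurable_const
  · have : Continuous fun t : Circle => ((t ^ k : Circle) : ℂ) :=
      continuous_subtype_val.comp (continuous_zpow k : Continuous fun t : Circle => t ^ k)
    exact this.aestronglyMeasurable
  · exact Filter.Eventually.of_forall fun t => (Circle.norm_coe _).le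
  · rw [hξ.integral_centered_mul_conj, hρ.fourier_eq]
    refine integral_congr_ae (Filter.Eventually.of_forall fun t => ?_)
    simp only
    rw [← Circle.coe_inv_eq_conj, ← Circle.coe_mul, ← zpow_neg, ← zpow_add]
    congr 2
    ring
  · filter_upwards [measure_eq_zero_iff_ae_notMem.1 hU] with t ht using hsupp t ht

end IsWideSenseStationary

/-! ### From prediction to periodicity. -/

/-- The points of a finite set are separated. -/
theorem Set.Finite.exists_pos_le_dist {E : Type*} [MetricSpace E] {X : Set E} (hX : X.Finite) :
    ∃ δ > 0, ∀ x ∈ X, ∀ y ∈ X, x ≠ y → δ ≤ dist x y := by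
  rcases (X.offDiag).eq_empty_or_nonempty with h | h
  · refine ⟨1, one_pos, fun x hx y hy hxy => ?_⟩
    have : (x, y) ∈ X.offDiag := ⟨hx, hy, hxy⟩
    simp [h] at this
  · obtain ⟨q, hq, hmin⟩ := Set.exists_min_image _ (fun q : E × E => dist q.1 q.2) hX.offDiag h
    exact ⟨dist q.1 q.2, dist_pos.2 hq.2.2, fun x hx y hy hxy => hmin (x, y) ⟨hx, hy, hxy⟩⟩

theorem theorem3p1 {Ω : Type*} [MeasurableSpace Ω] (P : Measure Ω) [IsProbabilityMeasure P]
    (X : Set ℂ) (hX : X.Finite) (ξ : ℤ → Ω → ℂ) (hξX : ∀ n, ∀ᵐ ω ∂P, ξ n ω ∈ X)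
    (hξ : IsWideSenseStationary ξ P)
    (ρ : Measure Circle) (hρ : IsSpectralMeasure ξ P ρ) (hgap : ρ.support ≠ Set.univ) :
    IsPeriodicProcess ξ P := by
  obtain ⟨t₀, ht₀⟩ := (Set.ne_univ_iff_exists_notMem _).1 hgap
  obtain ⟨U, hU, hρU⟩ := Measure.notMem_support_iff_exists.1 ht₀
  obtain ⟨ψ, hψ, hψ1, hne, hsupp⟩ := exists_summable_fourier_series_eq_zero_off t₀ hU
  set m := ∫ ω', ξ 0 ω' ∂P with hm
  obtain ⟨R, hR0, hR⟩ : ∃ R > 0, ∀ x ∈ X, ‖x - m‖ ≤ R := by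
    obtain ⟨R, hR⟩ := (hX.image fun x => ‖x - m‖).bddAbove
    exact ⟨max R 1, by positivity, fun x hx =>
      (hR (Set.mem_image_of_mem _ hx)).trans (le_max_left _ _)⟩
  obtain ⟨δ, hδ, hsep⟩ := hX.exists_pos_le_dist
  -- This makes the prediction error at most `δ / 3`, so two terms with the same following window
  -- are at distance at most `2δ / 3 < δ`. The polynomial is chosen before `ω`, hence the period is
  -- deterministic.
  obtain ⟨p, hp⟩ := exists_polynomial_prediction hψ hψ1 (Circle.norm_coe t₀)
    (by simpa using hne) (show 0 < δ / (3 * R) by positivity)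
  have := hX.fintype
  refine ⟨_, Nat.factorial_pos (Fintype.card X ^ (p.natDegree + 1)), ?_⟩
  have hzero := hξ.ae_tsum_mul_centered_eq_zero (R := R)
    (fun n => (hξX n).mono fun ω hω => hR _ hω) hρ hρU hψ hsupp
  filter_upwards [hzero, ae_all_iff.2 hξX] with ω hω hωX
  let y : ℤ → X := fun n => ⟨ξ n ω, hωX n⟩
  have hpred := hp (fun n => ξ n ω - m) R (fun n => hR _ (hωX n)) hω
  have hper : Function.Periodic y ((Fintype.card X ^ (p.natDegree + 1)).factorial : ℤ) := by
    refine periodic_of_determined_by_window (p.natDegree + 1) y fun n n' h => ?_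
    by_contra hnn
    have hdist := hsep _ (y n).2 _ (y n').2 fun h => hnn (Subtype.ext h)
    have h1 := hpred n
    have h2 := hpred n'
    have hsum : ∑ j ∈ Finset.range (p.natDegree + 1), p.coeff j * (ξ (n + 1 + j) ω - m) =
        ∑ j ∈ Finset.range (p.natDegree + 1), p.coeff j * (ξ (n' + 1 + j) ω - m) := by
      refine Finset.sum_congr rfl fun j hj => ?_
      have := congrArg Subtype.val (h ⟨j, Finset.mem_range.1 hj⟩)
      simp only [y] at this
      rw [this]
    rw [hsum] at h1
    have hε : δ / (3 * R) * R = δ / 3 := by field_simp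
    rw [hε] at h1 h2
    have h3 := norm_sub_le_of_le h1 h2
    rw [sub_sub_sub_cancel_right, sub_sub_sub_cancel_right, ← dist_eq_norm] at h3
    have : δ ≤ δ / 3 + δ / 3 := hdist.trans h3
    linarith
  intro n
  exact congrArg Subtype.val (hper n)
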